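/- A subset $A$ of an Abelian group is sum-free if there are no $x,y,z\in A$ (not necessarily distinct) with $x+y=z$. For a finite set $B$ in an Abelian group, let $\mathrm{SF}(B)$ denote the collection of all maximum-size sum-free subsets of $B$; call $B\subseteq G$ sum-free good if every $S\in\mathrm{SF}(B)$ is of the form $S=B\cap A$ for some $A\in\mathrm{SF}(G)$. The $p$-random subset $G_p$ of $G$ contains each element of $G$ independently with probability $p$. Let $n=q$ run over the primes with $q\equiv 2\pmod 3$, let $G=\mathbb{Z}_n$, and let $p=p(n)\in[0,1]$. All asymptotic notation refers to $n\to\infty$ along these primes, and $f\ll g$ means $f=o(g)$. 1. If $$\frac{\log n}{n}\;\ll\;p(n)\;\ll\;\left(\frac{1}{n\log n}\right)^{1/3},$$ then with probability tending to $1$ there exists a sum-free subset of $G_p$ which has strictly more elements than $A\cap G_p$ for every $A\in\mathrm{SF}(G)$. In particular, $\mathbb{P}(G_p\text{ is sum-free good})\to 0$. 2. Consequently, there is a choice of $p=p(n)$ with $p(n)\gg\sqrt{\log n/n}$ for which $\mathbb{P}(G_p\text{ is sum-free good})\to 0$. (So for these groups, unlike for groups of order $n\to\infty$ divisible by a fixed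 prime $q\equiv 2\pmod 3$, no constant $C$ is such that $p\geqslant C\sqrt{\log n/n}$ suffices for $G_p$ to be sum-free good with high probability: the hypothesis $n\gg q$ is needed.) -/

import Mathlib

namespace RandomSumFree

/-- A subset `A` of an Abelian group is sum-free if there is no solution of `x + y = z` with
`x, y, z ∈ A`, i.e. `(A + A) ∩ A = ∅` (the elements `x, y, z` need not be distinct). -/
def IsSumFree {G : Type*} [AddCommGroup G] (A : Set G) : Prop :=
  ∀ x ∈ A, ∀ y ∈ A, x + y ∉ A

/-- `SF B` is the collection of maximum-size sum-free subsets of a (finite) set `B`. -/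
def SF {G : Type*} [AddCommGroup G] (B : Set G) : Set (Set G) :=
  {A | A ⊆ B ∧ IsSumFree A ∧ ∀ A' : Set G, A' ⊆ B → IsSumFree A' → A'.ncard ≤ A.ncard}

/-- `B ⊆ G` is sum-free good if every maximum-size sum-free subset of `B` is of the form `B ∩ A`
for some maximum-size sum-free subset `A` of `G`. -/
def IsSumFreeGood {G : Type*} [AddCommGroup G] (B : Set G) : Prop :=
  ∀ S ∈ SF B, ∃ A ∈ SF (Set.univ : Set G), S = B ∩ A

/-- The law of the `p`-random subset `G_p` of `G`: each element of `G` is included with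
probability `p`, independently of all other elements. -/
noncomputable def randomSubset (G : Type*) (p : unitInterval) : MeasureTheory.Measure (Set G) :=
  ProbabilityTheory.setBernoulli (Set.univ : Set G) p

/-- `n → ∞` along the primes `n ≡ 2 (mod 3)`. -/
def primesTwoModThree : Filter ℕ :=
  Filter.atTop ⊓ Filter.principal {n : ℕ | n.Prime ∧ n % 3 = 2}

end RandomSumFree

/-!
For a prime `n = 3 k + 2` the maximum sum-free subsets of `ZMod n` have only `k + 1` elements, which
is the least integer above `n / 3`, and there are few of them. Indeed if `A` is such a set then
`A + A` lies in the complement of `A`, so that equality holds in the Cauchy–Davenport inequality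
`|A + A| ≥ 2 |A| - 1`, and Vosper's theorem makes `A + A`, which is the complement of `A`, an
arithmetic progression (`exists_add_eq_progression`, `SF_univ_structure`). Thus there are at most
`n ^ 2` maximum sum-free sets, and by Chernoff's bound and a union bound each of them meets the
random set in at most `(k + 1) p + O(√(n p log n))` elements.

On the other hand the interval `[k + 1 - 2 m, 2 k + 1 - m]` has `k + 1 + m` elements, and all its
Schur triples `x + y = z` come from solutions in the integers, at most `9 m ^ 2` in number.
Deleting the elements `z` of all Schur triples of its random part (`exists_isSumFree_of_schurPairs`)
costs about `m ^ 2 p ^ 3 + m p ^ 2` elements, by Markov's inequality. With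
`m = ε min(n, 1 / p ^ 2)` this is much less than the surplus `m p`, and the hypotheses
`log n / n ≪ p ≪ (1 / (n log n)) ^ (1/3)` say precisely that `m p` is also much larger than
`√(n p log n)`. The quantitative form is
`randomSubset_real_not_hasLargeSumFreeSubset_le_of_bounds`; it bounds the failure probability by a
multiple of `ε`, for each fixed `ε`, eventually. A sum-free subset of `B` larger than all `A ∩ B`
prevents `B` from being sum-free good. The second part follows by taking `p = n ^ (-2/5)`.
-/

namespace RandomSumFree

open Finset
open scoped Pointwise

/-! ### Critical pairs for the Cauchy–Davenport inequality -/

/-- The arithmetic progression `a, a + d, …, a + (l - 1) d` in `ZMod n`, as a finite set. -/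
def progression {n : ℕ} (a d : ZMod n) (l : ℕ) : Finset (ZMod n) :=
  (range l).image fun i : ℕ => a + i * d

/-- A proper subset of `ZMod p` in which at most one element `a` lacks its `d`-predecessor is a
progression of difference `d` starting at `a`: descending from any element in steps of `d` one
must leave the set, and one can only leave it at `a`. -/
lemma eq_progression_of_unique_start {p : ℕ} [Fact p.Prime] {S : Finset (ZMod p)} {a d : ZMod p}
    (hd : d ≠ 0) (hS : #S < p) (h : ∀ x ∈ S, x - d ∈ S ∨ x = a) :
    S = progression a d #S := by
  refine eq_of_subset_of_card_le (fun x hx => ?_) (card_image_le.trans (card_range _).le)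
  obtain ⟨y, hy⟩ : ∃ y, y ∉ S := by
    by_contra! hall
    have : S = univ := eq_univ_iff_forall.2 hall
    simp [this, ZMod.card] at hS
  have hleave : x - (((x - y) / d).val : ℕ) * d ∉ S := by
    rw [ZMod.natCast_zmod_val, div_mul_cancel₀ _ hd]
    simpa using hy
  classical
  have hex : ∃ j : ℕ, x - (j : ZMod p) * d ∉ S := ⟨_, hleave⟩
  set j := Nat.find hex with hj
  have hjp : j < p := (Nat.find_min' hex hleave).trans_lt (ZMod.val_lt _)
  have hin : ∀ i < j, x - (i : ZMod p) * d ∈ S := fun i hi => by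
    simpa using Nat.find_min hex hi
  have hout : x - (j : ZMod p) * d ∉ S := Nat.find_spec hex
  have hj0 : j ≠ 0 := fun h0 => hout (by simpa [h0] using hx)
  obtain ⟨i, hi⟩ := Nat.exists_eq_succ_of_ne_zero hj0
  have hia : x - (i : ZMod p) * d = a := by
    refine (h _ (hin i (by omega))).resolve_left fun hmem => hout ?_
    rw [hi]
    convert hmem using 1
    push_cast
    ring
  have hcard : j ≤ #S := by
    rw [← card_range j]
    refine card_le_card_of_injOn (fun i : ℕ => x - (i : ZMod p) * d)
      (fun i hi => hin i (by simpa using hi)) fun i₁ h₁ i₂ h₂ he => ?_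
    have he' : ((i₁ : ℕ) : ZMod p) = i₂ := mul_right_cancel₀ hd (sub_right_injective he)
    rw [ZMod.natCast_eq_natCast_iff', Nat.mod_eq_of_lt, Nat.mod_eq_of_lt] at he'
    · exact he'
    · exact (by simpa using h₂ : i₂ < j).trans hjp
    · exact (by simpa using h₁ : i₁ < j).trans hjp
  exact mem_image.2 ⟨i, mem_range.2 (by omega), by rw [← hia]; ring⟩

/-- The inductive step of Vosper's theorem: if `|t| ≥ 3`, some Dyson transform of a critical pair
`(s, t)` replaces `t` by a strictly smaller set which still has at least two elements. -/
lemma exists_shrinking_transform {p : ℕ} (hp : p.Prime) {s t : Finset (ZMod p)} (hs : 2 ≤ #s)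
    (ht : 3 ≤ #t) (hst : #(s + t) + 1 = #s + #t) (hstp : #(s + t) + 2 ≤ p) :
    ∃ e : ZMod p, 2 ≤ #(t ∩ (-e +ᵥ s)) ∧ #(t ∩ (-e +ᵥ s)) < #t := by
  by_contra! hno
  obtain ⟨t₀, ht₀⟩ : t.Nonempty := card_pos.1 (by omega)
  set X := s.filter fun x => ¬ ((x - t₀) +ᵥ t ⊆ s) with hX
  have hsub : t₀ +ᵥ s ⊆ s + t := by
    intro z hz
    obtain ⟨x, hx, rfl⟩ := mem_vadd_finset.1 hz
    rw [vadd_eq_add, add_comm t₀ x]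
    exact add_mem_add hx ht₀
  -- For `x ∈ X` the transform by `x - t₀` shrinks `t`, so it shrinks `t` to `{t₀}`.
  have hX1 : #X ≤ 1 := by
    by_contra! hX2
    have hsubX : X + t.erase t₀ ⊆ (s + t) \ (t₀ +ᵥ s) := by
      intro z hz
      obtain ⟨x, hx, b, hb, rfl⟩ := mem_add.1 hz
      obtain ⟨hxs, hxt⟩ := mem_filter.1 hx
      obtain ⟨hb0, hbt⟩ := mem_erase.1 hb
      refine mem_sdiff.2 ⟨add_mem_add hxs hbt, fun hmem => ?_⟩
      obtain ⟨y, hy, hye⟩ := mem_vadd_finset.1 hmem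
      rw [vadd_eq_add] at hye
      have hmem_iff : ∀ b : ZMod p, b ∈ -(x - t₀) +ᵥ s ↔ (x - t₀) + b ∈ s := fun b => by
        rw [mem_neg_vadd_finset_iff, vadd_eq_add]
      have h2 : 2 ≤ #(t ∩ (-(x - t₀) +ᵥ s)) := by
        refine one_lt_card.2 ⟨t₀, ?_, b, ?_, hb0.symm⟩
        · exact mem_inter.2 ⟨ht₀, (hmem_iff _).2 (by simpa using hxs)⟩
        · refine mem_inter.2 ⟨hbt, (hmem_iff _).2 ?_⟩
          have : x - t₀ + b = y := by linear_combination -hye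
          rwa [this]
      have heq := eq_of_subset_of_card_le inter_subset_left (hno _ h2)
      refine hxt fun z hz => ?_
      obtain ⟨c, hc, rfl⟩ := mem_vadd_finset.1 hz
      rw [← heq] at hc
      exact (hmem_iff c).1 (mem_inter.1 hc).2
    have hcd := ZMod.cauchy_davenport hp (s := X) (t := t.erase t₀) (card_pos.1 (by omega))
      (card_pos.1 (by rw [card_erase_of_mem ht₀]; omega))
    have hle := card_le_card hsubX
    rw [card_sdiff_of_subset hsub, card_vadd_finset] at hle
    rw [card_erase_of_mem ht₀] at hcd
    omega
  have hsubY : (s \ X) + t ⊆ t₀ +ᵥ s := by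
    intro z hz
    obtain ⟨x, hx, b, hb, rfl⟩ := mem_add.1 hz
    obtain ⟨hxs, hxX⟩ := mem_sdiff.1 hx
    have hxt : (x - t₀) +ᵥ t ⊆ s := by
      by_contra hcon
      exact hxX (mem_filter.2 ⟨hxs, hcon⟩)
    refine mem_vadd_finset.2 ⟨x - t₀ + b, hxt (mem_vadd_finset.2 ⟨b, hb, rfl⟩), ?_⟩
    rw [vadd_eq_add]
    ring
  -- Almost all of `s` thus satisfies `x + t ⊆ t₀ + s`, too much for Cauchy–Davenport if `|t| ≥ 3`.
  have hYcard : #(s \ X) = #s - #X := card_sdiff_of_subset (filter_subset _ _)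
  have hcd := ZMod.cauchy_davenport hp (s := s \ X) (t := t) (card_pos.1 (by omega))
    (card_pos.1 (by omega))
  have hle := card_le_card hsubY
  rw [card_vadd_finset] at hle
  omega

/-- The part of **Vosper's theorem** concerning the sumset: if equality holds in the
Cauchy–Davenport inequality and `s + t` misses at least two elements, then `s + t` is an
arithmetic progression. -/
theorem exists_add_eq_progression {p : ℕ} [Fact p.Prime] (s t : Finset (ZMod p)) (hs : 2 ≤ #s)
    (ht : 2 ≤ #t) (hst : #(s + t) + 1 = #s + #t) (hstp : #(s + t) + 2 ≤ p) :
    ∃ a d : ZMod p, s + t = progression a d #(s + t) := by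
  have hp : p.Prime := Fact.out
  induction hm : #t using Nat.strong_induction_on generalizing s t with
  | _ m ih =>
  subst hm
  obtain ht2 | ht3 : #t = 2 ∨ 3 ≤ #t := by omega
  · obtain ⟨u, v, huv, rfl⟩ := card_eq_two.1 ht2
    have hsub : v +ᵥ s ⊆ s + {u, v} := by
      intro z hz
      obtain ⟨x, hx, rfl⟩ := mem_vadd_finset.1 hz
      rw [vadd_eq_add, add_comm v x]
      exact add_mem_add hx (by simp)
    have hone : #((s + {u, v}) \ (v +ᵥ s)) = 1 := by
      rw [card_sdiff_of_subset hsub, card_vadd_finset]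
      omega
    obtain ⟨a, ha⟩ := card_eq_one.1 hone
    -- Only the element of `s + {u, v}` outside `v + s` can lack its predecessor.
    refine ⟨a, v - u, eq_progression_of_unique_start (sub_ne_zero.2 huv.symm) (by omega) ?_⟩
    intro x hx
    by_cases hxv : x ∈ v +ᵥ s
    · obtain ⟨y, hy, rfl⟩ := mem_vadd_finset.1 hxv
      left
      have : (v +ᵥ y) - (v - u) = y + u := by rw [vadd_eq_add]; ring
      rw [this]
      exact add_mem_add hy (by simp)
    · right
      simpa [ha] using mem_sdiff.2 ⟨hx, hxv⟩
  · obtain ⟨e, he2, het⟩ := exists_shrinking_transform hp hs ht3 hst hstp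
    have hcard : #(s ∪ (e +ᵥ t)) + #(t ∩ (-e +ᵥ s)) = #s + #t :=
      addDysonETransform.card e (s, t)
    have hsubset : (s ∪ (e +ᵥ t)) + (t ∩ (-e +ᵥ s)) ⊆ s + t :=
      addDysonETransform.subset e (s, t)
    have hs' : #s ≤ #(s ∪ (e +ᵥ t)) := card_le_card subset_union_left
    have hcd := ZMod.cauchy_davenport hp (s := s ∪ (e +ᵥ t)) (t := t ∩ (-e +ᵥ s))
      (card_pos.1 (by omega)) (card_pos.1 (by omega))
    have hle := card_le_card hsubset
    have heq := eq_of_subset_of_card_le hsubset (by omega)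
    have := ih _ het (s ∪ (e +ᵥ t)) (t ∩ (-e +ᵥ s)) (by omega) he2 (by rw [heq]; omega)
      (by rw [heq]; omega) rfl
    rwa [heq] at this

/-! ### Maximum sum-free subsets of `ZMod n` for primes `n = 3 k + 2` -/

/-- The image in `ZMod n` of the interval `[a, b]` of natural numbers. -/
def intervalMod (n a b : ℕ) : Finset (ZMod n) := (Icc a b).image fun i : ℕ => (i : ZMod n)

lemma card_intervalMod {n a b : ℕ} (hb : b < n) : #(intervalMod n a b) = b + 1 - a := by
  rw [intervalMod, card_image_of_injOn, Nat.card_Icc]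
  intro x hx y hy hxy
  have hx' := (mem_Icc.1 hx).2
  have hy' := (mem_Icc.1 hy).2
  simp only [ZMod.natCast_eq_natCast_iff'] at hxy
  rwa [Nat.mod_eq_of_lt (by omega), Nat.mod_eq_of_lt (by omega)] at hxy

/-- If `2 b < n + a`, the sum of two elements of `[a, b]` cannot wrap around modulo `n` and land
in `[a, b]` again. -/
lemma add_eq_of_natCast_add_eq {n a b x y z : ℕ} (hab : 2 * b < n + a) (hb : b < n)
    (hx : x ≤ b) (hy : y ≤ b) (hz : a ≤ z) (hzb : z ≤ b)
    (h : (x : ZMod n) + y = z) : x + y = z := by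
  have h' : ((x + y : ℕ) : ZMod n) = (z : ℕ) := by push_cast; exact h
  rw [ZMod.natCast_eq_natCast_iff', Nat.mod_eq_of_lt (hzb.trans_lt hb)] at h'
  have hlt : x + y < n + z := by omega
  obtain hlt' | hge := lt_or_ge (x + y) n
  · rwa [Nat.mod_eq_of_lt hlt'] at h'
  · rw [Nat.mod_eq_sub_mod hge, Nat.mod_eq_of_lt (by omega)] at h'
    omega

lemma isSumFree_intervalMod {n a b : ℕ} (hab : 2 * b < n + a) (hb : b < n) (hba : b < 2 * a) :
    IsSumFree (intervalMod n a b : Set (ZMod n)) := by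
  intro x hx y hy hxy
  simp only [intervalMod, mem_coe, mem_image, mem_Icc] at hx hy hxy
  obtain ⟨x, ⟨hx1, hx2⟩, rfl⟩ := hx
  obtain ⟨y, ⟨hy1, hy2⟩, rfl⟩ := hy
  obtain ⟨z, ⟨hz1, hz2⟩, hz⟩ := hxy
  have := add_eq_of_natCast_add_eq hab hb hx2 hy2 hz1 hz2 hz.symm
  omega

/-- For a prime `n = 3 k + 2` with `k ≥ 1`, a maximum sum-free subset of `ZMod n` has `k + 1`
elements and its complement is an arithmetic progression. Sum-freeness puts `A + A` inside the
complement of `A`; the Cauchy–Davenport inequality then forces `A + A` to be that complement and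
`(A, A)` to be a critical pair. -/
theorem SF_univ_structure {n k : ℕ} [Fact n.Prime] (hn : n = 3 * k + 2) (hk : 1 ≤ k)
    {A : Set (ZMod n)} (hA : A ∈ SF (Set.univ : Set (ZMod n))) :
    A.ncard = k + 1 ∧ ∃ a d : ZMod n, A = ((progression a d (2 * k + 1))ᶜ : Finset (ZMod n)) := by
  classical
  have hp : n.Prime := Fact.out
  obtain ⟨-, hfree, hmax⟩ := hA
  lift A to Finset (ZMod n) using A.toFinite
  have hlow : k + 1 ≤ #A := by
    have := hmax (intervalMod n (k + 1) (2 * k + 1)) (Set.subset_univ _)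
      (isSumFree_intervalMod (by omega) (by omega) (by omega))
    rw [Set.ncard_coe_finset, Set.ncard_coe_finset, card_intervalMod (by omega)] at this
    omega
  have hsub : A + A ⊆ Aᶜ := by
    intro z hz
    obtain ⟨x, hx, y, hy, rfl⟩ := mem_add.1 hz
    exact mem_compl.2 fun hmem => hfree x hx y hy hmem
  have hle := card_le_card hsub
  rw [card_compl, ZMod.card] at hle
  have hAn : #A ≤ n := (card_le_univ A).trans (ZMod.card n).le
  have hcd := ZMod.cauchy_davenport hp (s := A) (t := A) (card_pos.1 (by omega))
    (card_pos.1 (by omega))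
  have hcard : #A = k + 1 := by omega
  have heq : A + A = Aᶜ :=
    eq_of_subset_of_card_le hsub (by rw [card_compl, ZMod.card]; omega)
  have hadd : #(A + A) = 2 * k + 1 := by omega
  obtain ⟨a, d, had⟩ := exists_add_eq_progression A A (by omega) (by omega) (by omega) (by omega)
  refine ⟨by rw [Set.ncard_coe_finset, hcard], a, d, ?_⟩
  rw [← hadd, ← had, heq, compl_compl]

end RandomSumFree

namespace RandomSumFree

open Finset MeasureTheory ProbabilityTheory

/-! ### The random subset of a finite group -/

instance isProbabilityMeasure_randomSubset (G : Type*) (p : unitInterval) :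
    IsProbabilityMeasure (randomSubset G p) := by
  unfold randomSubset
  infer_instance

section Finite

variable {G : Type*} [Fintype G]

lemma measurableSet_of_fintype (E : Set (Set G)) : MeasurableSet E :=
  E.toFinite.measurableSet

lemma integrable_randomSubset (p : unitInterval) (F : Set G → ℝ) :
    Integrable F (randomSubset G p) :=
  have : MeasurableSingletonClass (Set G) := inferInstance
  Integrable.of_finite

variable [DecidableEq G]

/-- The expectation of a function of the random subset as a finite sum. -/
lemma integral_randomSubset (p : unitInterval) (F : Set G → ℝ) :
    ∫ B, F B ∂(randomSubset G p) =
      ∑ T : Finset G, (p : ℝ) ^ #T * (1 - (p : ℝ)) ^ #Tᶜ * F T := by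
  rw [integral_fintype (integrable_randomSubset p F),
    ← Fintype.sum_equiv (Fintype.finsetEquivSet (α := G)) _ _ fun T => rfl]
  refine sum_congr rfl fun T _ => ?_
  rw [Fintype.finsetEquivSet_apply, randomSubset,
    setBernoulli_real_singleton p (Set.subset_univ _) Set.finite_univ, Set.ncard_coe_finset,
    ← Set.compl_eq_univ_sdiff, ← coe_compl, Set.ncard_coe_finset, smul_eq_mul]

open Classical in
/-- Independence of the elements of the random subset, in product form. -/
lemma integral_randomSubset_prod (p : unitInterval) (f g : G → ℝ) :
    ∫ B, (∏ x, if x ∈ B then f x else g x) ∂(randomSubset G p) =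
      ∏ x, ((p : ℝ) * f x + (1 - (p : ℝ)) * g x) := by
  have hsplit : ∀ (T : Finset G) (B : Set G), B = T →
      (∏ x, if x ∈ B then f x else g x) = (∏ x ∈ T, f x) * ∏ x ∈ Tᶜ, g x := by
    rintro T B rfl
    rw [← prod_mul_prod_compl T]
    exact congr_arg₂ _ (prod_congr rfl fun x hx => if_pos (mem_coe.2 hx))
      (prod_congr rfl fun x hx => if_neg (mt mem_coe.1 (mem_compl.1 hx)))
  rw [integral_randomSubset, Fintype.prod_add]
  refine sum_congr rfl fun T _ => ?_
  rw [hsplit T T rfl, prod_mul_distrib, prod_mul_distrib, prod_const, prod_const]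
  ring

/-- The probability that the random subset contains a given set `T`. -/
lemma randomSubset_real_superset (p : unitInterval) (T : Finset G) :
    (randomSubset G p).real {B | (T : Set G) ⊆ B} = (p : ℝ) ^ #T := by
  classical
  have hind : ∀ B : Set G, {B : Set G | (T : Set G) ⊆ B}.indicator (1 : Set G → ℝ) B =
      ∏ x, if x ∈ B then (1 : ℝ) else if x ∈ T then 0 else 1 := by
    intro B
    by_cases h : (T : Set G) ⊆ B
    · rw [Set.indicator_of_mem (show B ∈ {B : Set G | (T : Set G) ⊆ B} from h)]
      refine (prod_eq_one fun x _ => ?_).symm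
      split_ifs with h1 h2
      · rfl
      · exact absurd (h h2) h1
      · rfl
    · rw [Set.indicator_of_notMem (show B ∉ {B : Set G | (T : Set G) ⊆ B} from h)]
      obtain ⟨x, hxT, hxB⟩ := Set.not_subset.1 h
      exact (prod_eq_zero (mem_univ x) (by rw [if_neg hxB, if_pos (mem_coe.1 hxT)])).symm
  rw [← integral_indicator_one (measurableSet_of_fintype _), integral_congr_ae (.of_forall hind),
    integral_randomSubset_prod, ← prod_mul_prod_compl T]
  rw [prod_congr rfl fun x hx => by rw [if_pos hx],
    prod_congr (s₁ := Tᶜ) rfl fun x hx => by rw [if_neg (mem_compl.1 hx)]]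
  simp

open Classical in
/-- The moment generating function of the binomial variable `|A ∩ B|`, bounded for small
arguments. -/
lemma integral_exp_card_inter_le (p : unitInterval) (A : Finset G) {s : ℝ} (hs : |s| ≤ 1) :
    ∫ B, Real.exp (s * ((A : Set G) ∩ B).ncard) ∂(randomSubset G p) ≤
      Real.exp (#A * p * (s + s ^ 2)) := by
  have hprod : ∀ B : Set G, Real.exp (s * ((A : Set G) ∩ B).ncard) =
      ∏ x, if x ∈ B then (if x ∈ A then Real.exp s else 1) else 1 := by
    intro B
    have h1 : ((A : Set G) ∩ B).ncard = #(A.filter fun x => x ∈ B) := by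
      rw [← Set.ncard_coe_finset]
      congr 1
      ext x
      simp
    have h2 : ∀ x : G, (if x ∈ B then (if x ∈ A then Real.exp s else 1) else 1) =
        if x ∈ A.filter (fun x => x ∈ B) then Real.exp s else 1 := by
      intro x
      by_cases hB : x ∈ B <;> by_cases hA : x ∈ A <;> simp [hA, hB]
    rw [prod_congr rfl fun x _ => h2 x, Fintype.prod_ite_mem, prod_const, ← Real.exp_nat_mul, h1,
      mul_comm]
  have hp0 : (0 : ℝ) ≤ p := p.2.1
  have hp1 : (p : ℝ) ≤ 1 := p.2.2
  have hexp : Real.exp s ≤ 1 + s + s ^ 2 := by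
    have := (abs_le.1 (Real.abs_exp_sub_one_sub_id_le hs)).2
    linarith
  rw [integral_congr_ae (.of_forall hprod), integral_randomSubset_prod]
  calc ∏ x, ((p : ℝ) * (if x ∈ A then Real.exp s else 1) + (1 - p) * 1)
      = ∏ x, (if x ∈ A then (p : ℝ) * Real.exp s + (1 - p) else 1) := by
        refine prod_congr rfl fun x _ => ?_
        split_ifs <;> ring
    _ = ((p : ℝ) * Real.exp s + (1 - p)) ^ #A := by
        rw [Fintype.prod_ite_mem, prod_const]
    _ ≤ Real.exp (p * (s + s ^ 2)) ^ #A := by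
        have h0 := Real.exp_pos s
        refine pow_le_pow_left₀ (by nlinarith) ?_ _
        have := Real.add_one_le_exp ((p : ℝ) * (s + s ^ 2))
        nlinarith
    _ = Real.exp (#A * p * (s + s ^ 2)) := by
        rw [← Real.exp_nat_mul, mul_assoc]

/-- Exponential Markov inequality for `|A ∩ B|`. A negative `s` gives the lower tail. -/
lemma randomSubset_real_exp_markov (p : unitInterval) (A : Finset G) {s : ℝ} (hs : |s| ≤ 1)
    (c : ℝ) :
    (randomSubset G p).real {B | s * c ≤ s * ((A : Set G) ∩ B).ncard} ≤
      Real.exp (#A * p * (s + s ^ 2) - s * c) := by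
  have hmarkov := mul_meas_ge_le_integral_of_nonneg (μ := randomSubset G p)
    (.of_forall fun B => (Real.exp_pos (s * ((A : Set G) ∩ B).ncard)).le)
    (integrable_randomSubset p _) (Real.exp (s * c))
  simp only [Real.exp_le_exp] at hmarkov
  rw [Real.exp_sub, le_div_iff₀ (Real.exp_pos _), mul_comm]
  exact hmarkov.trans (integral_exp_card_inter_le p A hs)

/-- Chernoff's bound for the upper tail, with deviations measured in units of `δ N p` for an upper
bound `N` of the size of `A`. -/
lemma randomSubset_real_upper_tail (p : unitInterval) (A : Finset G) {δ N : ℝ} (hδ0 : 0 ≤ δ)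
    (hδ : δ ≤ 2) (hN : #A ≤ N) :
    (randomSubset G p).real {B | #A * (p : ℝ) + δ * N * p ≤ ((A : Set G) ∩ B).ncard} ≤
      Real.exp (-(δ ^ 2 * N * p / 4)) := by
  have hp0 : (0 : ℝ) ≤ p := p.2.1
  have hs : |δ / 2| ≤ 1 := by rw [abs_of_nonneg (by positivity)]; linarith
  refine (measureReal_mono fun B hB => ?_).trans
    ((randomSubset_real_exp_markov p A hs (#A * (p : ℝ) + δ * N * p)).trans
      (Real.exp_le_exp.2 ?_))
  · rw [Set.mem_ofPred_eq] at hB ⊢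
    exact mul_le_mul_of_nonneg_left hB (by positivity : (0 : ℝ) ≤ δ / 2)
  · have : (#A : ℝ) * (p * δ ^ 2) ≤ N * (p * δ ^ 2) :=
      mul_le_mul_of_nonneg_right hN (by positivity)
    nlinarith

/-- Chernoff's bound for the lower tail. -/
lemma randomSubset_real_lower_tail (p : unitInterval) (A : Finset G) {δ N : ℝ} (hδ0 : 0 ≤ δ)
    (hδ : δ ≤ 2) (hN : #A ≤ N) :
    (randomSubset G p).real {B | (((A : Set G) ∩ B).ncard : ℝ) ≤ #A * (p : ℝ) - δ * N * p} ≤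
      Real.exp (-(δ ^ 2 * N * p / 4)) := by
  have hp0 : (0 : ℝ) ≤ p := p.2.1
  have hs : |(-(δ / 2))| ≤ 1 := by rw [abs_neg, abs_of_nonneg (by positivity)]; linarith
  refine (measureReal_mono fun B hB => ?_).trans
    ((randomSubset_real_exp_markov p A hs (#A * (p : ℝ) - δ * N * p)).trans
      (Real.exp_le_exp.2 ?_))
  · rw [Set.mem_ofPred_eq] at hB ⊢
    exact mul_le_mul_of_nonpos_left hB (by linarith : -(δ / 2) ≤ (0 : ℝ))
  · have : (#A : ℝ) * (p * δ ^ 2) ≤ N * (p * δ ^ 2) :=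
      mul_le_mul_of_nonneg_right hN (by positivity)
    nlinarith

open Classical in
/-- Markov's inequality for the number of members of a finite family of sets that are contained in
the random subset. -/
lemma randomSubset_real_count_ge {ι : Type*} (p : unitInterval) (P : Finset ι) (T : ι → Finset G)
    {c : ℝ} (hc : 0 < c) :
    (randomSubset G p).real {B | c ≤ #(P.filter fun i => (T i : Set G) ⊆ B)} ≤
      (∑ i ∈ P, (p : ℝ) ^ #(T i)) / c := by
  have hmarkov := mul_meas_ge_le_integral_of_nonneg (μ := randomSubset G p)
    (f := fun B => (#(P.filter fun i => (T i : Set G) ⊆ B) : ℝ))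
    (.of_forall fun B => Nat.cast_nonneg _) (integrable_randomSubset p _) c
  have hint : ∫ B, (#(P.filter fun i => (T i : Set G) ⊆ B) : ℝ) ∂(randomSubset G p) =
      ∑ i ∈ P, (p : ℝ) ^ #(T i) := by
    have hsum : ∀ B : Set G, (#(P.filter fun i => (T i : Set G) ⊆ B) : ℝ) =
        ∑ i ∈ P, {B : Set G | (T i : Set G) ⊆ B}.indicator (1 : Set G → ℝ) B := by
      intro B
      rw [card_filter]
      push_cast
      refine sum_congr rfl fun i _ => ?_
      simp [Set.indicator_apply]
    rw [integral_congr_ae (.of_forall hsum),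
      integral_finsetSum _ fun i _ => integrable_randomSubset p _]
    refine sum_congr rfl fun i _ => ?_
    rw [integral_indicator_one (measurableSet_of_fintype _), randomSubset_real_superset]
  rw [le_div_iff₀ hc, mul_comm, ← hint]
  exact hmarkov

end Finite

end RandomSumFree

namespace RandomSumFree

open Finset MeasureTheory

/-! ### A sum-free subset of the random set beating every maximum sum-free set -/

/-- `B` contains a sum-free set that is larger than `A ∩ B` for every maximum sum-free set `A`. -/
def HasLargeSumFreeSubset {G : Type*} [AddCommGroup G] (B : Set G) : Prop :=
  ∃ S ⊆ B, IsSumFree S ∧ ∀ A ∈ SF (Set.univ : Set G), (A ∩ B).ncard < S.ncard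

lemma HasLargeSumFreeSubset.not_isSumFreeGood {G : Type*} [AddCommGroup G] [Finite G] {B : Set G}
    (hB : HasLargeSumFreeSubset B) : ¬ IsSumFreeGood B := by
  intro hgood
  obtain ⟨S, hSB, hS, hlt⟩ := hB
  obtain ⟨S', ⟨hS'B, hS'⟩, hmax⟩ := Set.exists_max_image {S : Set G | S ⊆ B ∧ IsSumFree S}
    Set.ncard (Set.toFinite _) ⟨S, hSB, hS⟩
  obtain ⟨A, hA, hAS⟩ := hgood S' ⟨hS'B, hS', fun A' h1 h2 => hmax A' ⟨h1, h2⟩⟩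
  have h1 := hlt A hA
  have h2 := hmax S ⟨hSB, hS⟩
  rw [hAS, Set.inter_comm] at h2
  omega

/-- Representatives of the pairs `(x, y)` of elements of `[a, b]`, up to order, with `x + y` in
`[a, b]`. -/
def schurPairs (a b : ℕ) : Finset (ℕ × ℕ) :=
  (Icc a (b - a) ×ˢ Icc a (b - a)).filter fun q => q.1 ≤ q.2 ∧ q.1 + q.2 ≤ b

/-- The set `{x, y, x + y}` in `ZMod n`. -/
def schurTriple (n : ℕ) (q : ℕ × ℕ) : Finset (ZMod n) :=
  {(q.1 : ZMod n), (q.2 : ZMod n), ((q.1 + q.2 : ℕ) : ZMod n)}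

/-- Deleting from `intervalMod n a b ∩ B` every element which is a sum of two elements leaves a
sum-free set, and costs at most one element for each Schur triple. -/
lemma exists_isSumFree_of_schurPairs {n a b : ℕ} [NeZero n] (hab : 2 * b < n + a) (hb : b < n)
    (B : Set (ZMod n)) [DecidablePred fun q => (schurTriple n q : Set (ZMod n)) ⊆ B] :
    ∃ S ⊆ B, IsSumFree S ∧ ((intervalMod n a b : Set (ZMod n)) ∩ B).ncard ≤
      S.ncard + #((schurPairs a b).filter fun q => (schurTriple n q : Set (ZMod n)) ⊆ B) := by
  set W : Set (ZMod n) := (intervalMod n a b : Set (ZMod n)) ∩ B with hW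
  set D : Finset (ZMod n) := ((schurPairs a b).filter
    fun q => (schurTriple n q : Set (ZMod n)) ⊆ B).image
      fun q => ((q.1 + q.2 : ℕ) : ZMod n) with hD
  refine ⟨W \ D, Set.sdiff_subset.trans Set.inter_subset_right, ?_, ?_⟩
  · rintro x ⟨⟨hx, hxB⟩, -⟩ y ⟨⟨hy, hyB⟩, -⟩ ⟨⟨hz, hzB⟩, hzD⟩
    refine hzD ?_
    simp only [intervalMod, mem_coe, mem_image, mem_Icc] at hx hy hz
    obtain ⟨x, ⟨hx1, hx2⟩, rfl⟩ := hx
    obtain ⟨y, ⟨hy1, hy2⟩, rfl⟩ := hy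
    obtain ⟨z, ⟨hz1, hz2⟩, hz⟩ := hz
    have hsum := add_eq_of_natCast_add_eq hab hb hx2 hy2 hz1 hz2 hz.symm
    have key : ∀ x y : ℕ, a ≤ x → a ≤ y → x ≤ y → x + y = z → (x : ZMod n) ∈ B →
        (y : ZMod n) ∈ B → (x : ZMod n) + y ∈ B → (x : ZMod n) + y ∈ (D : Set (ZMod n)) := by
      intro x y hx hy hxy hsum hxB hyB hzB
      rw [mem_coe, hD, mem_image]
      refine ⟨(x, y), mem_filter.2 ⟨mem_filter.2 ⟨mem_product.2 ⟨?_, ?_⟩, hxy, ?_⟩, ?_⟩, ?_⟩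
      · exact mem_Icc.2 ⟨hx, by dsimp only; omega⟩
      · exact mem_Icc.2 ⟨hy, by dsimp only; omega⟩
      · dsimp only; omega
      · intro w hw
        simp only [schurTriple, coe_insert, coe_singleton, Set.mem_insert_iff,
          Set.mem_singleton_iff, Nat.cast_add] at hw
        rcases hw with rfl | rfl | rfl <;> assumption
      · push_cast
        rfl
    rcases le_total x y with hxy | hyx
    · exact key x y hx1 hy1 hxy hsum hxB hyB hzB
    · rw [add_comm] at hzB hsum ⊢
      exact key y x hy1 hx1 hyx hsum hyB hxB hzB
  · have h1 := Set.ncard_le_ncard_sdiff_add_ncard W D (Set.toFinite _)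
    rw [Set.ncard_coe_finset] at h1
    exact h1.trans (Nat.add_le_add_left card_image_le _)

lemma card_schurTriple {n a b : ℕ} (ha : 1 ≤ a) (hb : b < n) {q : ℕ × ℕ}
    (hq : q ∈ schurPairs a b) : #(schurTriple n q) = if q.1 = q.2 then 2 else 3 := by
  obtain ⟨x, y⟩ := q
  simp only [schurPairs, mem_filter, mem_product, mem_Icc] at hq
  have hinj : ∀ u v : ℕ, u < n → v < n → u ≠ v → (u : ZMod n) ≠ v := by
    intro u v hu hv huv h
    rw [ZMod.natCast_eq_natCast_iff', Nat.mod_eq_of_lt hu, Nat.mod_eq_of_lt hv] at h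
    exact huv h
  have h2 := hinj y (x + y) (by omega) (by omega) (by omega)
  split_ifs with h
  · dsimp only at h
    subst h
    rw [schurTriple, insert_eq_of_mem (mem_insert_self _ _), card_pair h2]
  · exact card_eq_three.2 ⟨_, _, _, hinj x y (by omega) (by omega) h,
      hinj x (x + y) (by omega) (by omega) (by omega), h2, rfl⟩

/-- The expected number of Schur triples in the random part of an interval. -/
lemma sum_pow_card_schurTriple_le {n a b : ℕ} (ha : 1 ≤ a) (hb : b < n) {p : ℝ} (hp : 0 ≤ p) :
    ∑ q ∈ schurPairs a b, p ^ #(schurTriple n q) ≤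
      ((b - a + 1 - a : ℕ) : ℝ) ^ 2 * p ^ 3 + ((b - a + 1 - a : ℕ) : ℝ) * p ^ 2 := by
  calc ∑ q ∈ schurPairs a b, p ^ #(schurTriple n q)
      ≤ ∑ q ∈ schurPairs a b, (p ^ 3 + if q.1 = q.2 then p ^ 2 else 0) := by
        refine sum_le_sum fun q hq => ?_
        rw [card_schurTriple ha hb hq]
        split_ifs
        · have := pow_nonneg hp 3
          linarith
        · rw [add_zero]
    _ ≤ ∑ q ∈ Icc a (b - a) ×ˢ Icc a (b - a), (p ^ 3 + if q.1 = q.2 then p ^ 2 else 0) := by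
        refine sum_le_sum_of_subset_of_nonneg (filter_subset _ _) fun q _ _ => ?_
        split_ifs <;> positivity
    _ = _ := by
        rw [sum_add_distrib, sum_const, card_product, Nat.card_Icc, nsmul_eq_mul, sum_product,
          sum_congr rfl fun x hx => by rw [sum_ite_eq, if_pos hx], sum_const, Nat.card_Icc,
          nsmul_eq_mul, Nat.cast_mul, sq (Nat.cast _ : ℝ)]

/-- With high probability `A ∩ B` is not too large for any maximum sum-free set `A`: by
`SF_univ_structure` there are at most `n ^ 2` such sets, so a union bound applies. -/
lemma randomSubset_real_exists_SF_large {n k : ℕ} [Fact n.Prime] (hn : n = 3 * k + 2) (hk : 1 ≤ k)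
    (p : unitInterval) {δ : ℝ} (hδ0 : 0 ≤ δ) (hδ : δ ≤ 2) :
    (randomSubset (ZMod n) p).real {B | ∃ A ∈ SF (Set.univ : Set (ZMod n)),
        ((k + 1 : ℕ) : ℝ) * p + δ * n * p ≤ (A ∩ B).ncard} ≤
      (n : ℝ) ^ 2 * Real.exp (-(δ ^ 2 * n * p / 4)) := by
  set C : ZMod n × ZMod n → Finset (ZMod n) := fun q => (progression q.1 q.2 (2 * k + 1))ᶜ
  set Q : Finset (ZMod n × ZMod n) := univ.filter fun q => #(C q) = k + 1
  have hQ : (#Q : ℝ) ≤ (n : ℝ) ^ 2 := by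
    have h1 : #Q ≤ n * n := (card_filter_le _ _).trans
      (by rw [card_univ, Fintype.card_prod, ZMod.card])
    rw [sq]
    exact_mod_cast h1
  have hsub : {B : Set (ZMod n) | ∃ A ∈ SF (Set.univ : Set (ZMod n)),
        ((k + 1 : ℕ) : ℝ) * p + δ * n * p ≤ (A ∩ B).ncard} ⊆
      ⋃ q ∈ Q, {B | #(C q) * (p : ℝ) + δ * n * p ≤ ((C q : Set (ZMod n)) ∩ B).ncard} := by
    rintro B ⟨A, hA, hAB⟩
    obtain ⟨hcard, a, d, rfl⟩ := SF_univ_structure hn hk hA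
    rw [Set.ncard_coe_finset] at hcard
    refine Set.mem_biUnion (x := (a, d)) (mem_filter.2 ⟨mem_univ _, hcard⟩) ?_
    rw [Set.mem_ofPred_eq, show #(C (a, d)) = k + 1 from hcard]
    exact hAB
  calc _ ≤ _ := measureReal_mono hsub (measure_ne_top _ _)
    _ ≤ ∑ q ∈ Q, _ := measureReal_biUnion_finset_le _ _
    _ ≤ ∑ q ∈ Q, Real.exp (-(δ ^ 2 * n * p / 4)) := by
        refine sum_le_sum fun q _ => randomSubset_real_upper_tail p (C q) hδ0 hδ ?_
        exact_mod_cast (card_le_univ (C q)).trans (ZMod.card n).le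
    _ = #Q * Real.exp (-(δ ^ 2 * n * p / 4)) := by rw [sum_const, nsmul_eq_mul]
    _ ≤ _ := mul_le_mul_of_nonneg_right hQ (Real.exp_pos _).le

/-- The interval `[k + 1 - 2 m, 2 k + 1 - m]` has `m` elements more than a maximum sum-free set,
but few Schur triples. The surplus `m p` of its random part exceeds the sum of the fluctuations and
of the number of Schur triples, outside an event of the stated probability. -/
theorem randomSubset_real_not_hasLargeSumFreeSubset_le {n k m : ℕ} [Fact n.Prime]
    (hn : n = 3 * k + 2) (hk : 1 ≤ k) (hm : 1 ≤ m) (hmk : 2 * m ≤ k) (p : unitInterval)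
    (hp : 0 < (p : ℝ)) :
    (randomSubset (ZMod n) p).real {B | ¬ HasLargeSumFreeSubset B} ≤
      ((n : ℝ) ^ 2 + 1) * Real.exp (-((m : ℝ) ^ 2 * p / (64 * n))) +
        (18 * m * (p : ℝ) ^ 2 + 6 * p) := by
  classical
  set a := k + 1 - 2 * m with ha
  set b := 2 * k + 1 - m with hb
  have hn0 : (0 : ℝ) < n := by exact_mod_cast (by omega : 0 < n)
  have hm0 : (0 : ℝ) < m := by exact_mod_cast hm
  have hmn : (m : ℝ) ≤ n := by exact_mod_cast (by omega : m ≤ n)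
  -- Both tail bounds are applied with deviation `δ n p = m p / 4`, a quarter of the surplus.
  set δ : ℝ := m / (4 * n) with hδdef
  have hδ0 : 0 ≤ δ := by positivity
  have hδ2 : δ ≤ 2 := by
    rw [hδdef, div_le_iff₀ (by positivity)]
    linarith
  have hδn : δ * n * p = m * p / 4 := by rw [hδdef]; field_simp
  have hexp : δ ^ 2 * n * p / 4 = (m : ℝ) ^ 2 * p / (64 * n) := by
    rw [hδdef]; field_simp; norm_num
  set I := intervalMod n a b with hI
  have hIcard : #I = k + 1 + m := by rw [hI, card_intervalMod (by omega)]; omega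
  have hF1 := randomSubset_real_exists_SF_large hn hk p hδ0 hδ2
  have hF2 := randomSubset_real_lower_tail p I hδ0 hδ2 (N := n)
    (by exact_mod_cast (card_le_univ I).trans (ZMod.card n).le)
  have hF3 := randomSubset_real_count_ge p (schurPairs a b) (schurTriple n)
    (c := m * p / 2) (by positivity)
  rw [hexp] at hF1 hF2
  -- Here `b - 2 a + 1 = 3 m` is the number of `x ≥ a` with `x + a ≤ b`.
  have hF3' : (∑ q ∈ schurPairs a b, (p : ℝ) ^ #(schurTriple n q)) / (m * p / 2) ≤
      18 * m * (p : ℝ) ^ 2 + 6 * p := by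
    rw [div_le_iff₀ (by positivity)]
    refine (sum_pow_card_schurTriple_le (by omega) (by omega) hp.le).trans (le_of_eq ?_)
    rw [show b - a + 1 - a = 3 * m by omega]
    push_cast
    ring
  have hsub : {B : Set (ZMod n) | ¬ HasLargeSumFreeSubset B} ⊆
      ({B | ∃ A ∈ SF (Set.univ : Set (ZMod n)),
          ((k + 1 : ℕ) : ℝ) * p + δ * n * p ≤ (A ∩ B).ncard} ∪
        {B | (((I : Set (ZMod n)) ∩ B).ncard : ℝ) ≤ #I * (p : ℝ) - δ * n * p}) ∪
        {B | (m : ℝ) * p / 2 ≤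
          (#((schurPairs a b).filter fun q => (schurTriple n q : Set (ZMod n)) ⊆ B) : ℝ)} := by
    intro B hB
    by_contra hcon
    simp only [Set.mem_union, Set.mem_ofPred_eq, not_or, not_exists, not_and, not_le] at hcon
    obtain ⟨⟨h1, h2⟩, h3⟩ := hcon
    obtain ⟨S, hSB, hS, hcount⟩ :=
      exists_isSumFree_of_schurPairs (n := n) (a := a) (b := b) (by omega) (by omega) B
    refine hB ⟨S, hSB, hS, fun A hA => ?_⟩
    have hA' := h1 A hA
    have hcount' : (((I : Set (ZMod n)) ∩ B).ncard : ℝ) ≤ S.ncard +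
        #((schurPairs a b).filter fun q => (schurTriple n q : Set (ZMod n)) ⊆ B) := by
      exact_mod_cast hcount
    rw [hIcard, hδn] at h2
    rw [hδn] at hA'
    push_cast at h2 hA'
    have : ((A ∩ B).ncard : ℝ) < S.ncard := by linarith
    exact_mod_cast this
  have hu1 := measureReal_union_le (μ := randomSubset (ZMod n) p)
    ({B | ∃ A ∈ SF (Set.univ : Set (ZMod n)),
          ((k + 1 : ℕ) : ℝ) * p + δ * n * p ≤ (A ∩ B).ncard})
    {B | (((I : Set (ZMod n)) ∩ B).ncard : ℝ) ≤ #I * (p : ℝ) - δ * n * p}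
  refine (measureReal_mono hsub).trans ((measureReal_union_le _ _).trans ?_)
  linarith

end RandomSumFree

namespace RandomSumFree

open Filter Topology Asymptotics MeasureTheory

/-! ### Asymptotics -/

/-- The choice of the surplus `m ≈ ε min(n, 1 / p ^ 2)`. It is as large as the number of Schur
triples permits, and the two bounds on `p` say that the surplus `m p` then exceeds the fluctuations,
which are of order `√(n p log n)`: the lower bound does so when `n` is the minimum, the upper bound
when `1 / p ^ 2` is. -/
lemma randomSubset_real_not_hasLargeSumFreeSubset_le_of_bounds {n : ℕ} (hprime : n.Prime)
    (hmod : n % 3 = 2) (p : unitInterval) {ε : ℝ} (hε : 0 < ε) (hε1 : ε ≤ 1 / 16)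
    (hnε : 2 / ε ≤ n) (hlow : Real.log n / n ≤ ε ^ 2 / 768 * p)
    (hupp : (p : ℝ) ≤ ε ^ 2 / 768 * (1 / ((n : ℝ) * Real.log n)) ^ (1 / 3 : ℝ)) :
    (randomSubset (ZMod n) p).real {B | ¬ HasLargeSumFreeSubset B} ≤ 25 * ε := by
  have : Fact n.Prime := ⟨hprime⟩
  set q : ℝ := (p : ℝ) with hq
  set c : ℝ := ε ^ 2 / 768 with hc
  have hc0 : 0 < c := by positivity
  have hcε : c ≤ ε / 2 := by rw [hc]; nlinarith
  have hn32 : (32 : ℝ) ≤ n := by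
    rw [div_le_iff₀ hε] at hnε
    nlinarith [(Nat.cast_nonneg n : (0 : ℝ) ≤ n)]
  have hn0 : (0 : ℝ) < n := by linarith
  have hlog : 1 ≤ Real.log n := by
    rw [Real.le_log_iff_exp_le hn0]
    linarith [Real.exp_one_lt_d9]
  have hlog0 : 0 < Real.log n := by linarith
  have hq0 : 0 < q := by
    have : 0 < Real.log n / n := by positivity
    by_contra! hle
    nlinarith
  have hnl : 1 ≤ (n : ℝ) * Real.log n := by nlinarith
  have hqc : q ≤ c := by
    have : (1 / ((n : ℝ) * Real.log n)) ^ (1 / 3 : ℝ) ≤ 1 :=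
      Real.rpow_le_one (by positivity) ((div_le_one (by linarith)).2 hnl) (by norm_num)
    nlinarith
  have hcube : q ^ 3 * (n * Real.log n) ≤ c ^ 3 := by
    have h1 := pow_le_pow_left₀ hq0.le hupp 3
    rw [mul_pow, ← Real.rpow_natCast (_ ^ (1 / 3 : ℝ)), ← Real.rpow_mul (by positivity)] at h1
    norm_num at h1
    rw [← mul_inv, ← div_eq_mul_inv, le_div_iff₀ (by positivity)] at h1
    rwa [mul_comm (n : ℝ)]
  set R : ℝ := min n (1 / q ^ 2) with hR
  have hRn : R ≤ n := min_le_left _ _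
  have hRq : R * q ^ 2 ≤ 1 := by
    rw [← le_div_iff₀ (by positivity)]
    exact min_le_right _ _
  have hεR : 2 ≤ ε * R := by
    rw [← div_le_iff₀' hε]
    refine le_min hnε ?_
    rw [div_le_div_iff₀ hε (by positivity)]
    nlinarith
  have hR0 : 0 < R := lt_min hn0 (by positivity)
  obtain ⟨m, hmle, hmge⟩ : ∃ m : ℕ, (m : ℝ) ≤ ε * R ∧ ε * R / 2 ≤ m :=
    ⟨⌊ε * R⌋₊, Nat.floor_le (by linarith), by linarith [Nat.lt_floor_add_one (ε * R)]⟩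
  obtain ⟨k, hk⟩ : ∃ k, n = 3 * k + 2 := ⟨n / 3, by omega⟩
  have hn32' : 32 ≤ n := by exact_mod_cast hn32
  have hm1 : 1 ≤ m := by
    have : (1 : ℝ) ≤ m := by linarith
    exact_mod_cast this
  have hmn : 16 * m ≤ n := by
    have : (16 : ℝ) * m ≤ n := by nlinarith
    exact_mod_cast this
  have hmain : 3 * Real.log n ≤ (m : ℝ) ^ 2 * q / (64 * n) := by
    rw [le_div_iff₀ (by positivity)]
    have hm2 : (ε * R / 2) ^ 2 ≤ (m : ℝ) ^ 2 := pow_le_pow_left₀ (by positivity) hmge 2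
    have hRR : 768 * (n * Real.log n) ≤ ε ^ 2 * R ^ 2 * q := by
      rcases min_choice (n : ℝ) (1 / q ^ 2) with h | h
      · rw [hR, h]
        rw [div_le_iff₀ hn0, hc] at hlow
        nlinarith
      · rw [hR, h]
        have hc3 : c ^ 3 ≤ c := by
          have := pow_le_of_le_one hc0.le (by linarith : c ≤ 1) (three_ne_zero)
          exact this
        have : q ^ 3 * (n * Real.log n) ≤ ε ^ 2 / 768 := hcube.trans (hc3.trans hc.le)
        have heq : ε ^ 2 * (1 / q ^ 2) ^ 2 * q = ε ^ 2 / q ^ 3 := by field_simp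
        rw [heq, le_div_iff₀ (by positivity)]
        linarith
    nlinarith
  have hbound := randomSubset_real_not_hasLargeSumFreeSubset_le hk (by omega) hm1 (by omega) p hq0
  have hexp : Real.exp (-((m : ℝ) ^ 2 * q / (64 * n))) ≤ 1 / (n : ℝ) ^ 3 := by
    refine (Real.exp_le_exp.2 (neg_le_neg hmain)).trans (le_of_eq ?_)
    rw [Real.exp_neg, one_div, show 3 * Real.log n = ((3 : ℕ) : ℝ) * Real.log n by norm_num,
      Real.exp_nat_mul, Real.exp_log hn0]
  have hfirst : ((n : ℝ) ^ 2 + 1) * Real.exp (-((m : ℝ) ^ 2 * q / (64 * n))) ≤ ε := by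
    calc _ ≤ ((n : ℝ) ^ 2 + 1) * (1 / (n : ℝ) ^ 3) :=
          mul_le_mul_of_nonneg_left hexp (by positivity)
      _ ≤ 2 / n := by
          rw [mul_one_div, div_le_div_iff₀ (by positivity) hn0]
          nlinarith [mul_pos hn0 hn0]
      _ ≤ ε := by
          rw [div_le_iff₀ hn0]
          rwa [div_le_iff₀' hε] at hnε
  have hsecond : (m : ℝ) * q ^ 2 ≤ ε := by
    have h1 : (m : ℝ) * q ^ 2 ≤ ε * R * q ^ 2 := mul_le_mul_of_nonneg_right hmle (by positivity)
    have h2 : ε * (R * q ^ 2) ≤ ε * 1 := mul_le_mul_of_nonneg_left hRq hε.le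
    linarith
  linarith

lemma tendsto_not_hasLargeSumFreeSubset {p : ℕ → unitInterval}
    (hlow : (fun n : ℕ => Real.log n / n) =o[primesTwoModThree] (fun n : ℕ => (p n : ℝ)))
    (hupp : (fun n : ℕ => (p n : ℝ)) =o[primesTwoModThree]
      (fun n : ℕ => (1 / ((n : ℝ) * Real.log n)) ^ (1 / 3 : ℝ))) :
    Tendsto (fun n : ℕ => (randomSubset (ZMod n) (p n)).real {B | ¬ HasLargeSumFreeSubset B})
      primesTwoModThree (𝓝 0) := by
  refine Metric.tendsto_nhds.2 fun η hη => ?_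
  set ε : ℝ := min (1 / 16) (η / 50)
  have hε : 0 < ε := by positivity
  have hc : 0 < ε ^ 2 / 768 := by positivity
  have hprimes : ∀ᶠ n in primesTwoModThree, n.Prime ∧ n % 3 = 2 :=
    mem_inf_of_right (mem_principal_self _)
  have hlarge : ∀ᶠ n : ℕ in primesTwoModThree, 2 / ε ≤ n :=
    (tendsto_natCast_atTop_atTop.eventually_ge_atTop (2 / ε)).filter_mono inf_le_left
  filter_upwards [hprimes, hlarge, hlow.bound hc, hupp.bound hc] with n hn hnε h1 h2
  rw [Real.norm_of_nonneg (p n).2.1] at h1 h2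
  rw [Real.norm_of_nonneg (by positivity)] at h1 h2
  have := randomSubset_real_not_hasLargeSumFreeSubset_le_of_bounds hn.1 hn.2 (p n) hε
    (min_le_left _ _) hnε h1 h2
  rw [dist_zero_right, Real.norm_of_nonneg measureReal_nonneg]
  linarith [min_le_right (1 / 16) (η / 50)]

lemma tendsto_hasLargeSumFreeSubset_one {p : ℕ → unitInterval}
    (h : Tendsto (fun n : ℕ => (randomSubset (ZMod n) (p n)).real {B | ¬ HasLargeSumFreeSubset B})
      primesTwoModThree (𝓝 0)) :
    Tendsto (fun n : ℕ => (randomSubset (ZMod n) (p n)).real {B | HasLargeSumFreeSubset B})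
      primesTwoModThree (𝓝 1) := by
  have h1 := h.const_sub 1
  rw [sub_zero] at h1
  refine tendsto_of_tendsto_of_tendsto_of_le_of_le h1 tendsto_const_nhds (fun n => ?_)
    fun n => measureReal_le_one
  have := measureReal_union_le (μ := randomSubset (ZMod n) (p n))
    {B | HasLargeSumFreeSubset B} {B | ¬ HasLargeSumFreeSubset B}
  have huniv : {B : Set (ZMod n) | HasLargeSumFreeSubset B} ∪ {B | ¬ HasLargeSumFreeSubset B} =
      Set.univ := Set.eq_univ_of_forall fun B => em _
  rw [huniv, probReal_univ] at this
  dsimp only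
  linarith

lemma tendsto_isSumFreeGood_zero {p : ℕ → unitInterval}
    (h : Tendsto (fun n : ℕ => (randomSubset (ZMod n) (p n)).real {B | ¬ HasLargeSumFreeSubset B})
      primesTwoModThree (𝓝 0)) :
    Tendsto (fun n : ℕ => (randomSubset (ZMod n) (p n)).real {B | IsSumFreeGood B})
      primesTwoModThree (𝓝 0) := by
  refine tendsto_of_tendsto_of_tendsto_of_le_of_le' tendsto_const_nhds h
    (.of_forall fun n => measureReal_nonneg) ?_
  have hprimes : ∀ᶠ n in primesTwoModThree, n.Prime ∧ n % 3 = 2 :=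
    mem_inf_of_right (mem_principal_self _)
  filter_upwards [hprimes] with n hn
  have : NeZero n := ⟨hn.1.ne_zero⟩
  exact measureReal_mono fun B hB hlarge => hlarge.not_isSumFreeGood hB

/-- The density `n ^ (-2/5)`, which lies strictly between `√(log n / n)` and
`(1 / (n log n)) ^ (1/3)`. -/
noncomputable def intermediateDensity (n : ℕ) : unitInterval :=
  ⟨(n : ℝ) ^ (-(2 / 5) : ℝ), by positivity, by
    rcases Nat.eq_zero_or_pos n with rfl | hn
    · rw [Nat.cast_zero, Real.zero_rpow (by norm_num)]
      exact zero_le_one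
    · exact Real.rpow_le_one_of_one_le_of_nonpos (by exact_mod_cast hn) (by norm_num)⟩

lemma log_natCast_isLittleO {r : ℝ} (hr : 0 < r) :
    (fun n : ℕ => Real.log n) =o[atTop] (fun n : ℕ => (n : ℝ) ^ r) :=
  (isLittleO_log_rpow_atTop hr).comp_tendsto tendsto_natCast_atTop_atTop

lemma log_div_isLittleO {r : ℝ} (hr : -1 < r) :
    (fun n : ℕ => Real.log n / n) =o[atTop] (fun n : ℕ => (n : ℝ) ^ r) := by
  refine ((log_natCast_isLittleO (r := r + 1) (by linarith)).mul_isBigO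
    (isBigO_refl (fun n : ℕ => (n : ℝ)⁻¹) atTop)).congr' (.of_forall fun n => rfl) ?_
  filter_upwards [eventually_gt_atTop 0] with n hn
  have hn' : (0 : ℝ) < n := by exact_mod_cast hn
  rw [Real.rpow_add_one hn'.ne', mul_inv_cancel_right₀ hn'.ne']

lemma log_div_isLittleO_intermediateDensity :
    (fun n : ℕ => Real.log n / n) =o[atTop] (fun n : ℕ => (intermediateDensity n : ℝ)) :=
  log_div_isLittleO (by norm_num)

lemma sqrt_log_div_isLittleO_intermediateDensity :
    (fun n : ℕ => Real.sqrt (Real.log n / n)) =o[atTop]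
      (fun n : ℕ => (intermediateDensity n : ℝ)) := by
  refine IsLittleO.of_pow (n := 2) ?_ two_ne_zero
  refine (log_div_isLittleO (r := -(4 / 5)) (by norm_num)).congr (fun n => ?_) fun n => ?_
  · rw [Pi.pow_apply, Real.sq_sqrt (div_nonneg (Real.log_natCast_nonneg n) (Nat.cast_nonneg n))]
  · rw [Pi.pow_apply, intermediateDensity, ← Real.rpow_natCast, ← Real.rpow_mul (Nat.cast_nonneg n)]
    norm_num

lemma intermediateDensity_isLittleO :
    (fun n : ℕ => (intermediateDensity n : ℝ)) =o[atTop]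
      (fun n : ℕ => (1 / ((n : ℝ) * Real.log n)) ^ (1 / 3 : ℝ)) := by
  refine IsLittleO.of_pow (n := 3) ?_ three_ne_zero
  have hlog := (log_natCast_isLittleO (r := 1 / 5) (by norm_num)).inv_rev (by
    filter_upwards [eventually_gt_atTop 1] with n hn h0
    exact absurd h0 (Real.log_pos (by exact_mod_cast hn)).ne')
  refine (hlog.mul_isBigO (isBigO_refl (fun n : ℕ => (n : ℝ)⁻¹) atTop)).congr' ?_ ?_
  · filter_upwards [eventually_gt_atTop 0] with n hn
    have hn' : (0 : ℝ) < n := by exact_mod_cast hn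
    rw [Pi.pow_apply, intermediateDensity, ← Real.rpow_natCast, ← Real.rpow_mul hn'.le,
      ← Real.rpow_neg hn'.le, ← Real.rpow_neg_one (n : ℝ), ← Real.rpow_add hn']
    norm_num
  · refine .of_forall fun n => ?_
    have h0 : 0 ≤ 1 / ((n : ℝ) * Real.log n) :=
      one_div_nonneg.2 (mul_nonneg (Nat.cast_nonneg n) (Real.log_natCast_nonneg n))
    rw [Pi.pow_apply, ← Real.rpow_natCast, ← Real.rpow_mul h0]
    norm_num

end RandomSumFree

open RandomSumFree Filter Topology Asymptotics in
theorem mainTheorem5 :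
    (∀ p : ℕ → unitInterval,
      (fun n : ℕ => Real.log n / n) =o[primesTwoModThree] (fun n : ℕ => (p n : ℝ)) →
      (fun n : ℕ => (p n : ℝ)) =o[primesTwoModThree]
        (fun n : ℕ => (1 / ((n : ℝ) * Real.log n)) ^ (1 / 3 : ℝ)) →
      Tendsto
        (fun n : ℕ => (randomSubset (ZMod n) (p n)).real
          {B | ∃ S ⊆ B, IsSumFree S ∧
            ∀ A ∈ SF (Set.univ : Set (ZMod n)), (A ∩ B).ncard < S.ncard})
        primesTwoModThree (𝓝 1) ∧
      Tendsto
        (fun n : ℕ => (randomSubset (ZMod n) (p n)).real {B | IsSumFreeGood B})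
        primesTwoModThree (𝓝 0)) ∧
    (∃ p : ℕ → unitInterval,
      (fun n : ℕ => Real.sqrt (Real.log n / n)) =o[primesTwoModThree] (fun n : ℕ => (p n : ℝ)) ∧
      Tendsto
        (fun n : ℕ => (randomSubset (ZMod n) (p n)).real {B | IsSumFreeGood B})
        primesTwoModThree (𝓝 0)) := by
  refine ⟨fun p hlow hupp => ?_, intermediateDensity,
    sqrt_log_div_isLittleO_intermediateDensity.mono inf_le_left, ?_⟩
  · have h := tendsto_not_hasLargeSumFreeSubset hlow hupp
    exact ⟨tendsto_hasLargeSumFreeSubset_one h, tendsto_isSumFreeGood_zero h⟩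
  · exact tendsto_isSumFreeGood_zero (tendsto_not_hasLargeSumFreeSubset
      (log_div_isLittleO_intermediateDensity.mono inf_le_left)
      (intermediateDensity_isLittleO.mono inf_le_left))
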